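/- Let $n\ge 2$, let $\langle x,y\rangle=x_1y_1+\dots+x_ny_n-x_{n+1}y_{n+1}$ be the Lorentz form on $\mathbb{R}^{n+1}$, and let $\mathbb{H}^n=\{x\in\mathbb{R}^{n+1}:\langle x,x\rangle=-1,\ x_{n+1}>0\}$ be hyperbolic space with the Riemannian metric induced by $\langle\cdot,\cdot\rangle$; write $\nabla$ and $\operatorname{div}_{\mathbb{H}^n}$ for its gradient and divergence. Let $\Omega\subset\mathbb{H}^n$ be a bounded domain, let $\mathcal{C}_{A}=\{\rho q: q\in A,\ \rho>0\}$ denote the cone spanned by a set $A\subset\mathbb H^n$, and let $H\in C^1(\mathcal{C}_{\overline\Omega})$. Here $C^k$ up to the closure means: $C^k$ on the open set ($\Omega$, respectively $\mathcal C_\Omega$), continuous on $\overline\Omega$ (respectively $\mathcal C_{\overline\Omega}$), with all derivatives of order at most $k$ extending continuously to $\overline\Omega$ (respectively $\mathcal C_{\overline\Omega}$). Let $r_1,r_2\in\mathbb{R}$ satisfy $0<r_1\le 1\le r_2$ and $r_1\ne r_2$, and let $\nu_0>0$. Then there is a constant $C>0$, depending only on $n,r_1,r_2,\nu_0,\Omega,H$,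 such that for every $t\in[0,1]$ and every $u\in C^3(\overline\Omega)$ that solves $$\begin{cases}-\operatorname{div}_{\mathbb{H}^n}\!\left(\dfrac{\nabla u}{\sqrt{1-|\nabla u|^2}}\right)+\dfrac{nt}{\sqrt{1-|\nabla u|^2}}=nt\,e^{u}H(e^{u}q)&\text{for } q\in\Omega,\\ |\nabla u|<1&\text{in }\Omega,\\ u=0&\text{on }\partial\Omega,\end{cases}$$ and satisfies $\log r_1\le u\le\log r_2$ in $\Omega$ and $\sup_{\partial\Omega}\nu\le\nu_0$, where $\nu=(1-|\nabla u|^2)^{-1/2}$ (with $\nu=+\infty$ where $|\nabla u|=1$, so that in particular $|\nabla u|<1$ on $\partial\Omega$; on $\partial\Omega$, $\nabla u$ is the continuous extension of the gradient from $\Omega$), one has $$\sup_{\Omega}\nu\le C.$$ -/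

import Mathlib

namespace HBump

noncomputable section

/-- The vector space underlying the Lorentz–Minkowski space `𝕃^{n+1}`. -/
abbrev L (n : ℕ) : Type := EuclideanSpace ℝ (Fin (n + 1))

variable {n : ℕ}

/-- The Lorentz form `⟨x, y⟩ = x₁ y₁ + ⋯ + xₙ yₙ - xₙ₊₁ yₙ₊₁`. -/
def lor (x y : L n) : ℝ :=
  (∑ i : Fin n, x i.castSucc * y i.castSucc) - x (Fin.last n) * y (Fin.last n)

/-- The modulus `|v| = √|⟨v, v⟩|`. -/
def lmod (v : L n) : ℝ := Real.sqrt |lor v v|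

/-- Hyperbolic space `ℍⁿ`, as the upper sheet of the hyperboloid. -/
def hyp (n : ℕ) : Set (L n) := {x | lor x x = -1 ∧ 0 < x (Fin.last n)}

/-- The Riemannian distance of `ℍⁿ`: `cosh d(p, q) = -⟨p, q⟩`. -/
def hdist (p q : L n) : ℝ := Real.arcosh (-lor p q)

/-- A bounded domain of `ℍⁿ`: a nonempty connected (relatively) open subset of `ℍⁿ` that is
bounded for the hyperbolic distance. -/
structure IsBoundedDomain (Ω : Set (L n)) : Prop where
  isOpen : ∃ U : Set (L n), IsOpen U ∧ Ω = hyp n ∩ U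
  isConnected : IsConnected Ω
  bounded : ∃ R : ℝ, ∀ p ∈ Ω, ∀ q ∈ Ω, hdist p q ≤ R

/-- The boundary in `ℍⁿ` of a relatively open subset of `ℍⁿ`. Since `ℍⁿ` is closed in `𝕃^{n+1}`,
the closure in `ℍⁿ` is the closure in `𝕃^{n+1}`. -/
def bdry (Ω : Set (L n)) : Set (L n) := closure Ω \ Ω

/-- The cone `{ρ q : q ∈ A, ρ > 0}` spanned by `A`. -/
def cone (A : Set (L n)) : Set (L n) := {x | ∃ q ∈ A, ∃ ρ : ℝ, 0 < ρ ∧ x = ρ • q}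

/-- The extension, constant along rays, of a map defined on (a part of) `ℍⁿ` to the cone over it. -/
def radialExt {F : Type*} (f : L n → F) (x : L n) : F := f ((lmod x)⁻¹ • x)

/-- `f ∈ C^k` up to the boundary, for an open set `U` and a set `K` between `U` and its closure:
`f` is `C^k` on `U` and continuous on `K`, and every derivative of order at most `k` has a
continuous extension from `U` to `K`. -/
def ContDiffUpTo (k : ℕ) (f : L n → ℝ) (U K : Set (L n)) : Prop :=
  ContDiffOn ℝ k f U ∧ ContinuousOn f K ∧
    ∀ j : ℕ, j ≤ k → ∃ g : L n → ContinuousMultilinearMap ℝ (fun _ : Fin j => L n) ℝ,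
      ContinuousOn g K ∧ Set.EqOn (iteratedFDeriv ℝ j f) g U

/-- `u ∈ C^k(Ω̄)` for `Ω` open in `ℍⁿ`. Only the values of `u` on `Ω̄` matter. -/
def MemCkClosure (k : ℕ) (u : L n → ℝ) (Ω : Set (L n)) : Prop :=
  ContDiffUpTo k (radialExt u) (cone Ω) (cone (closure Ω))

/-- The vector `v` with `⟨v, X⟩ = φ X` for all `X ∈ 𝕃^{n+1}`. -/
def sharp (φ : L n →L[ℝ] ℝ) : L n :=
  WithLp.toLp 2 fun i =>
    if i = Fin.last n then -φ (EuclideanSpace.single i 1) else φ (EuclideanSpace.single i 1)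

/-- The gradient `∇u` on `ℍⁿ`: the tangent vector at `q` with `⟨∇u, X⟩ = du(X)` for `X` in
`T_q ℍⁿ = {X : ⟨X, q⟩ = 0}`. (It is tangent because the radial extension has derivative zero
in the direction `q`.) -/
def hgrad (u : L n → ℝ) (q : L n) : L n := sharp (fderiv ℝ (radialExt u) q)

/-- The Lorentz-orthogonal projection of `w` to `T_q ℍⁿ`, for `q ∈ ℍⁿ`. -/
def tangentProj (q w : L n) : L n := w + lor w q • q

/-- The Levi-Civita connection of `ℍⁿ`: `∇_X V` at `q` is the tangential part of the derivative of
the tangent field `V` in the direction `X ∈ T_q ℍⁿ`. (For `X = q` it is zero.) -/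
def covDeriv (V : L n → L n) (q X : L n) : L n :=
  tangentProj q (fderiv ℝ (radialExt V) q X)

/-- The divergence on `ℍⁿ` of a tangent field: the trace of `X ↦ ∇_X V`. The trace is taken over
`𝕃^{n+1} = T_q ℍⁿ ⊕ ℝ q`, where the summand `ℝ q` contributes zero. -/
def hdiv (V : L n → L n) (q : L n) : ℝ :=
  ∑ i : Fin (n + 1), covDeriv V q (EuclideanSpace.single i 1) i

/-- `ν = 1 / √(1 - |v|²)` as a function of the gradient `v`; used only where `|v| < 1`. -/
def nu (v : L n) : ℝ := 1 / Real.sqrt (1 - lmod v ^ 2)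

/-- The gradient of `u ∈ C¹(Ω̄)` at points of the closure of `Ω`, where it is the limit of the
gradient from inside `Ω`. -/
def hgradBar (u : L n → ℝ) (Ω : Set (L n)) : L n → L n := extendFrom Ω (hgrad u)

/-- `u` solves
`-div (∇u / √(1 - |∇u|²)) + n t / √(1 - |∇u|²) = n t e^u H(e^u q)` in `Ω`, `|∇u| < 1` in `Ω`,
`u = 0` on `∂Ω`. -/
structure IsSolution (Ω : Set (L n)) (H : L n → ℝ) (t : ℝ) (u : L n → ℝ) : Prop where
  eqn : ∀ q ∈ Ω,
    -hdiv (fun p => nu (hgrad u p) • hgrad u p) q + n * t * nu (hgrad u q) =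
      n * t * Real.exp (u q) * H (Real.exp (u q) • q)
  spacelike : ∀ q ∈ Ω, lmod (hgrad u q) < 1
  boundary : ∀ q ∈ bdry Ω, u q = 0

end

end HBump

/-! This is an interior gradient estimate by Bernstein's method, applied to the auxiliary function
`log ν + (n/2) u²`. The function attains its maximum on the compact closure. At a boundary point `u
= 0` and `ν ≤ ν₀`, so the maximum is at most `log ν₀`.

At an interior maximum, the second-order conditions are traced against the coefficients `g + ν² ∇u ⊗
∇u` of the principal part, and third derivatives are eliminated with the equation differentiated
along `∇u`. Commuting derivatives costs the Ricci term `-(n - 1)|∇u|²ν²`. The second derivative `n`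
of the quadratic term in `u` outweighs it by exactly one, leaving `|∇u|²ν² = ν² - 1` on the good
side. The first-order condition turns the Hessian term on the right into one of lower order, so the
right side grows at most linearly in `ν`. Hence `ν² - 1 ≤ aν + b`, with `a` and `b` independent of
`t` and `u`.

No covariant calculus is needed: `u` is extended to the cone with degree 0, and ordinary derivatives
in Minkowski space are used. Euler's relations determine the radial components, and these carry the
curvature of `ℍⁿ`. The algebra at a point is `bernstein_pointwise`, the calculus is in
`IsSolution.deriv_trace_eq` and `second_order_of_isLocalMax_aux`, and the maximum argument is
`nu_hgrad_le`. -/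

namespace HBump

noncomputable section

variable {n : ℕ}

/-! ### The Lorentz form and orthonormal tangent frames -/

/-- The Lorentz form as a continuous bilinear map. -/
def lorL : L n →L[ℝ] L n →L[ℝ] ℝ :=
  (LinearMap.mk₂ ℝ (lor (n := n))
    (fun x y z => by
      simp only [lor, PiLp.add_apply, add_mul, Finset.sum_add_distrib]; ring)
    (fun c x y => by
      simp only [lor, PiLp.smul_apply, smul_eq_mul, mul_sub, Finset.mul_sum, mul_assoc])
    (fun x y z => by
      simp only [lor, PiLp.add_apply, mul_add, Finset.sum_add_distrib]; ring)
    (fun c x y => by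
      simp only [lor, PiLp.smul_apply, smul_eq_mul, mul_sub, Finset.mul_sum,
        mul_left_comm])).toContinuousBilinearMap

lemma lorL_apply (x y : L n) : lorL x y = lor x y := rfl

lemma lor_comm (x y : L n) : lor x y = lor y x := by
  simp only [lor, mul_comm]

lemma lor_add_left (x y z : L n) : lor (x + y) z = lor x z + lor y z := by
  simp only [← lorL_apply, map_add, add_apply]

lemma lor_add_right (x y z : L n) : lor x (y + z) = lor x y + lor x z := by
  simp only [← lorL_apply, map_add]

lemma lor_smul_left (c : ℝ) (x y : L n) : lor (c • x) y = c * lor x y := by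
  simp only [← lorL_apply, map_smul, smul_apply, smul_eq_mul]

lemma lor_smul_right (c : ℝ) (x y : L n) : lor x (c • y) = c * lor x y := by
  simp only [← lorL_apply, map_smul, smul_eq_mul]

lemma lor_neg_left (x y : L n) : lor (-x) y = -lor x y := by
  simp only [← lorL_apply, map_neg, neg_apply]

lemma lor_neg_right (x y : L n) : lor x (-y) = -lor x y := by
  simp only [← lorL_apply, map_neg]

lemma lor_single_castSucc (x : L n) (i : Fin n) :
    lor x (EuclideanSpace.single i.castSucc 1) = x i.castSucc := by
  simp [lor, (Fin.castSucc_ne_last _).symm]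

lemma lor_single_last (x : L n) :
    lor x (EuclideanSpace.single (Fin.last n) 1) = - x (Fin.last n) := by
  simp [lor, Fin.castSucc_ne_last]

lemma sum_single (x : L n) :
    ∑ i : Fin (n + 1), x i • (EuclideanSpace.single i 1 : L n) = x := by
  ext j
  simp [Pi.single_apply]

/-- The Lorentz-orthonormal frame of `T_q ℍⁿ` obtained by boosting the standard basis. -/
def frame (q : L n) (i : Fin n) : L n :=
  EuclideanSpace.single i.castSucc 1 +
    (q i.castSucc / (1 + q (Fin.last n))) • (q + EuclideanSpace.single (Fin.last n) 1)

lemma lor_frame_self (q : L n) (hq : q ∈ hyp n) (i : Fin n) : lor (frame q i) q = 0 := by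
  have h1 : (1 + q (Fin.last n)) ≠ 0 := by have := hq.2; positivity
  rw [frame, lor_add_left, lor_smul_left, lor_add_left, hq.1, lor_comm _ q, lor_comm _ q,
    lor_single_castSucc, lor_single_last]
  field_simp
  ring

lemma lor_frame_frame (q : L n) (hq : q ∈ hyp n) (i : Fin n) :
    lor (frame q i) (frame q i) = 1 := by
  have h1 : (1 + q (Fin.last n)) ≠ 0 := by have := hq.2; positivity
  have h2 : lor (frame q i) (EuclideanSpace.single (Fin.last n) 1) = - q i.castSucc := by
    rw [lor_single_last, frame]
    simp [(Fin.castSucc_ne_last i).symm]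
    field_simp
    ring
  have h3 : lor (frame q i) (EuclideanSpace.single i.castSucc 1) =
      1 + q i.castSucc ^ 2 / (1 + q (Fin.last n)) := by
    rw [lor_single_castSucc, frame]
    simp [Fin.castSucc_ne_last i]
    ring
  have h4 : lor (frame q i) (frame q i) = lor (frame q i) (EuclideanSpace.single i.castSucc 1) +
      (q i.castSucc / (1 + q (Fin.last n))) * (lor (frame q i) q +
        lor (frame q i) (EuclideanSpace.single (Fin.last n) 1)) := by
    rw [← lor_add_right, ← lor_smul_right, ← lor_add_right]
    rfl
  rw [h4, h2, h3, lor_frame_self q hq]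
  field_simp
  ring

lemma sum_sq_castSucc (q : L n) (hq : q ∈ hyp n) :
    ∑ i : Fin n, q i.castSucc ^ 2 = q (Fin.last n) ^ 2 - 1 := by
  have := hq.1
  simp only [lor, ← sq] at this
  linarith

/-- The trace of a bilinear form over the tangent frame at `q`. -/
lemma sum_frame (q : L n) (hq : q ∈ hyp n) (B : L n →ₗ[ℝ] L n →ₗ[ℝ] ℝ) :
    ∑ i, B (frame q i) (frame q i) =
      (∑ i : Fin n, B (EuclideanSpace.single i.castSucc 1) (EuclideanSpace.single i.castSucc 1)) -
        B (EuclideanSpace.single (Fin.last n) 1) (EuclideanSpace.single (Fin.last n) 1) + B q q := by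
  have h1 : (1 + q (Fin.last n)) ≠ 0 := by have := hq.2; positivity
  set τ := q (Fin.last n) with hτ
  set e : L n := EuclideanSpace.single (Fin.last n) 1 with he
  have hsum : ∑ i : Fin n, q i.castSucc • (EuclideanSpace.single i.castSucc 1 : L n) =
      q - τ • e := by
    have := sum_single q
    rw [Fin.sum_univ_castSucc] at this
    rw [eq_sub_iff_add_eq]; exact this
  have hs1 : ∀ v, ∑ i : Fin n, q i.castSucc * B (EuclideanSpace.single i.castSucc 1) v =
      B q v - τ * B e v := by
    intro v
    have := congrArg (fun z => B z v) hsum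
    simpa [map_sum, LinearMap.sum_apply] using this
  have hs2 : ∀ v, ∑ i : Fin n, q i.castSucc * B v (EuclideanSpace.single i.castSucc 1) =
      B v q - τ * B v e := by
    intro v
    have := congrArg (fun z => B v z) hsum
    simpa [map_sum] using this
  have hexp : ∀ i : Fin n, B (frame q i) (frame q i) =
      B (EuclideanSpace.single i.castSucc 1) (EuclideanSpace.single i.castSucc 1)
      + (q i.castSucc * B (EuclideanSpace.single i.castSucc 1) (q + e)) / (1 + τ)
      + (q i.castSucc * B (q + e) (EuclideanSpace.single i.castSucc 1)) / (1 + τ)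
      + q i.castSucc ^ 2 * (B (q + e) (q + e) / (1 + τ) ^ 2) := by
    intro i
    rw [frame, ← hτ, ← he]
    generalize q + e = v
    simp only [map_add, map_smul, LinearMap.add_apply, LinearMap.smul_apply, smul_eq_mul]
    field_simp
    ring
  simp only [hexp, Finset.sum_add_distrib, ← Finset.sum_div, ← Finset.sum_mul, hs1, hs2,
    sum_sq_castSucc q hq, ← hτ]
  simp only [map_add, LinearMap.add_apply]
  field_simp
  ring

/-- The trace of an endomorphism of `𝕃^{n+1}`. -/
def tr (M : L n →L[ℝ] L n) : ℝ := ∑ i : Fin (n + 1), M (EuclideanSpace.single i 1) i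

/-- The frame together with `q` is a Lorentz-orthonormal basis; the timelike vector `q` enters a
trace with a minus sign, which the last term undoes. -/
lemma sum_lor_frame_map (q : L n) (hq : q ∈ hyp n) (M : L n →L[ℝ] L n) :
    ∑ i, lor (M (frame q i)) (frame q i) = tr M + lor (M q) q := by
  have h := sum_frame q hq ((lorL (n := n)).toLinearMap₁₂.comp M.toLinearMap)
  simp only [LinearMap.comp_apply, ContinuousLinearMap.toLinearMap₁₂_apply_apply_apply,
    ContinuousLinearMap.coe_coe, lorL_apply, lor_single_castSucc, lor_single_last] at h
  rw [h, tr, Fin.sum_univ_castSucc]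
  ring

lemma parseval (q : L n) (hq : q ∈ hyp n) (X Y : L n) :
    ∑ i, lor X (frame q i) * lor Y (frame q i) = lor X Y + lor X q * lor Y q := by
  have h := sum_frame q hq ((LinearMap.mul ℝ ℝ).compl₁₂ (lorL X).toLinearMap (lorL Y).toLinearMap)
  simp only [LinearMap.compl₁₂_apply, LinearMap.mul_apply',
    ContinuousLinearMap.coe_coe, lorL_apply, lor_single_castSucc, lor_single_last] at h
  rw [h]
  simp only [lor]
  ring

/-- By `parseval`, only the component along the timelike `q` can contribute negatively. In
particular the form is nonnegative on tangent vectors. -/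
lemma neg_sq_le_lor (q : L n) (hq : q ∈ hyp n) (X : L n) : -(lor X q) ^ 2 ≤ lor X X := by
  have h := parseval q hq X X
  have : 0 ≤ ∑ i, lor X (frame q i) * lor X (frame q i) :=
    Finset.sum_nonneg fun i _ => mul_self_nonneg _
  nlinarith

lemma lor_self_nonneg_of_tangent (q : L n) (hq : q ∈ hyp n) (X : L n) (hX : lor X q = 0) :
    0 ≤ lor X X := by
  have := neg_sq_le_lor q hq X
  rw [hX] at this
  linarith

/-! ### The algebraic core of the Bernstein argument -/

/-- The pointwise Bernstein inequality. Here `p`, `A`, `T` play the roles of the gradient and of its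
first two derivatives at `q`, and `f₁`, `f₂` those of the first two derivatives of the auxiliary
function of the height. -/
lemma bernstein_pointwise (q : L n) (hq : q ∈ hyp n) (p : L n) (A : L n →L[ℝ] L n)
    (T : L n →L[ℝ] L n →L[ℝ] L n) (hpq : lor p q = 0)
    (hA : ∀ X Y, lor (A X) Y = lor X (A Y)) (hT : ∀ X Y, T X Y = T Y X)
    (hTl : ∀ X Y Z, lor (T X Y) Z = lor (T X Z) Y) (hAq : A q = -p)
    (hTq : ∀ X, T X q = -(2 : ℝ) • A X) (N f₁ f₂ κ κ' : ℝ) (hN : N ^ 2 * (1 - lor p p) = 1)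
    (first : ∀ X, lor X q = 0 → N ^ 2 * lor (A X) p + f₁ * lor p X = 0)
    (second : ∀ X, lor X q = 0 →
      N ^ 2 * (-lor X X * lor p p + lor (A X) (A X) + lor (T X X) p) +
        2 * N ^ 4 * lor (A X) p ^ 2 + f₁ * lor (A X) X + f₂ * lor p X ^ 2 ≤ 0)
    (eq₀ : tr A + N ^ 2 * lor (A p) p = κ)
    (eq₁ : tr (T p) + N ^ 2 * (lor (T p p) p + 2 * lor (A p) (A p)) +
      2 * N ^ 4 * lor (A p) p ^ 2 = κ') :
    N ^ 2 * κ' + f₁ * κ + (f₂ - (n - 1)) * (lor p p * N ^ 2) ≤ 0 := by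
  set w := lor p p with hw
  have hN0 : N ≠ 0 := by rintro rfl; simp at hN
  have hw0 : 0 ≤ w := lor_self_nonneg_of_tangent q hq p hpq
  -- By the first-order condition, `p` is an eigenvector of the tangential part of `A`, with
  -- eigenvalue `l = -f₁ / N²`.
  obtain ⟨l, hl⟩ : ∃ l, N ^ 2 * l = -f₁ := ⟨-f₁ / N ^ 2, by field_simp⟩
  have hAX : ∀ X, lor X q = 0 → lor (A X) p = l * lor p X := by
    intro X hX
    have h := first X hX
    have : N ^ 2 * (lor (A X) p - l * lor p X) = 0 := by linear_combination h - lor p X * hl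
    have := (mul_eq_zero.1 this).resolve_left (by positivity)
    linarith
  have hAp : lor (A p) p = l * w := hAX p hpq
  have hApq : lor (A p) q = -w := by rw [hA, hAq, lor_neg_right]
  have hApAp : lor (A p) (A p) = l ^ 2 * w - w ^ 2 := by
    have h := parseval q hq (A p) (A p)
    have h2 : ∀ i, lor (A p) (frame q i) = l * lor p (frame q i) := by
      intro i
      rw [hA, lor_comm, hAX _ (lor_frame_self q hq i)]
    have h3 := parseval q hq p p
    simp only [h2] at h
    have h4 : ∑ i, l * lor p (frame q i) * (l * lor p (frame q i)) =
        l ^ 2 * ∑ i, lor p (frame q i) * lor p (frame q i) := by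
      rw [Finset.mul_sum]; exact Finset.sum_congr rfl fun _ _ => by ring
    rw [h4, h3, hApq, hpq] at h
    linarith
  -- The symmetries of `T` move `p` into the first slot. The radial term `T p q = -2 A p` then
  -- contributes `2w`, part of the curvature contribution.
  have hsumT : ∑ i, lor (T (frame q i) (frame q i)) p = tr (T p) + 2 * w := by
    have h := sum_lor_frame_map q hq (T p)
    rw [hTq, lor_smul_left, hApq] at h
    rw [show (2 : ℝ) * w = -2 * -w by ring, ← h]
    exact Finset.sum_congr rfl fun i _ => by rw [hTl, hT]
  have hsumA : ∑ i, lor (A (frame q i)) (frame q i) = tr A := by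
    rw [sum_lor_frame_map q hq, hAq, lor_neg_left, hpq]; ring
  have hsump : ∑ i, lor p (frame q i) ^ 2 = w := by
    have h := parseval q hq p p
    simp only [← sq, hpq] at h
    rw [h]; ring
  -- The tangential part of `A X` has nonnegative square; only the radial component `-⟨p, X⟩` is
  -- negative.
  have hsumAA : -w ≤ ∑ i, lor (A (frame q i)) (A (frame q i)) := by
    rw [← hsump, ← Finset.sum_neg_distrib]
    refine Finset.sum_le_sum fun i _ => ?_
    have h := neg_sq_le_lor q hq (A (frame q i))
    rwa [hA, hAq, lor_neg_right, neg_sq, lor_comm] at h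
  have hframe : ∑ i, (N ^ 2 * (-w + lor (A (frame q i)) (A (frame q i)) +
      lor (T (frame q i) (frame q i)) p) + 2 * N ^ 4 * l ^ 2 * lor p (frame q i) ^ 2 +
      f₁ * lor (A (frame q i)) (frame q i) + f₂ * lor p (frame q i) ^ 2) ≤ 0 := by
    refine Finset.sum_nonpos fun i _ => ?_
    have h := second _ (lor_frame_self q hq i)
    rw [hAX _ (lor_frame_self q hq i), lor_frame_frame q hq] at h
    linarith
  simp only [Finset.sum_add_distrib, ← Finset.mul_sum, hsumT, hsumA, hsump, Finset.sum_const,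
    Finset.card_univ, Fintype.card_fin, nsmul_eq_mul] at hframe
  have hp := second p hpq
  rw [hAp, hApAp] at hp
  rw [hAp] at eq₀
  rw [hAp, hApAp] at eq₁
  -- Adding `N²` times the inequality for `X = p` to the frame sum gives the trace against `g + N² p
  -- ⊗ p`.
  have hp' := mul_nonneg_of_nonpos_of_nonpos (neg_nonpos.2 (sq_nonneg N)) hp
  have hAA' := mul_le_mul_of_nonneg_left hsumAA (sq_nonneg N)
  -- The Hessian squares leave the surplus `N⁴ l² w`, which has the favourable sign and is dropped.
  have hsq : 0 ≤ N ^ 4 * l ^ 2 * w := by positivity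
  have hN4 : N ^ 2 * w = N ^ 2 - 1 := by linear_combination -hN
  rw [← eq₀, ← eq₁]
  linear_combination hframe + hp' + hAA' + hsq - f₂ * w * hN4

/-! ### Homogeneous extension to the cone -/

open Filter Topology

lemma lor_sharp (φ : L n →L[ℝ] ℝ) (X : L n) : lor (sharp φ) X = φ X := by
  conv_rhs => rw [← sum_single X, map_sum]
  simp only [lor, sharp, map_smul, smul_eq_mul, Fin.sum_univ_castSucc, Fin.castSucc_ne_last,
    if_false, if_true]
  simp only [mul_comm]
  ring

/-- The musical isomorphism `sharp` as a continuous linear map. -/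
def sharpL : (L n →L[ℝ] ℝ) →L[ℝ] L n :=
  LinearMap.toContinuousLinearMap
    { toFun := sharp
      map_add' := fun φ ψ => by
        ext i; simp only [sharp, PiLp.add_apply, add_apply]; split_ifs <;> ring
      map_smul' := fun c φ => by
        ext i
        simp only [sharp, PiLp.smul_apply, smul_apply, smul_eq_mul, RingHom.id_apply]
        split_ifs <;> ring }

lemma sharpL_apply (φ : L n →L[ℝ] ℝ) : sharpL φ = sharp φ := rfl

lemma lor_hgrad (u : L n → ℝ) (x X : L n) :
    lor (hgrad u x) X = fderiv ℝ (radialExt u) x X := lor_sharp _ _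

lemma lor_left_injective {x y : L n} (h : ∀ z, lor x z = lor y z) : x = y := by
  ext i
  rcases Fin.eq_castSucc_or_eq_last i with ⟨j, rfl⟩ | rfl
  · simpa only [lor_single_castSucc] using h (EuclideanSpace.single j.castSucc 1)
  · simpa only [lor_single_last, neg_inj] using h (EuclideanSpace.single (Fin.last n) 1)

lemma lmod_smul {c : ℝ} (hc : 0 < c) (x : L n) : lmod (c • x) = c * lmod x := by
  rw [lmod, lmod, lor_smul_left, lor_smul_right, ← mul_assoc, abs_mul, Real.sqrt_mul (abs_nonneg _),
    abs_mul_self, Real.sqrt_mul_self hc.le]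

lemma lmod_of_mem_hyp {q : L n} (hq : q ∈ hyp n) : lmod q = 1 := by
  simp [lmod, hq.1]

lemma radialExt_smul {F : Type*} (f : L n → F) {c : ℝ} (hc : 0 < c) (x : L n) :
    radialExt f (c • x) = radialExt f x := by
  rw [radialExt, radialExt, lmod_smul hc, smul_smul, mul_inv, mul_right_comm,
    inv_mul_cancel₀ hc.ne', one_mul]

lemma radialExt_of_mem_hyp {F : Type*} (f : L n → F) {q : L n} (hq : q ∈ hyp n) :
    radialExt f q = f q := by
  rw [radialExt, lmod_of_mem_hyp hq, inv_one, one_smul]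

lemma hgrad_smul (u : L n → ℝ) {c : ℝ} (hc : 0 < c) (x : L n) :
    hgrad u (c • x) = c⁻¹ • hgrad u x := by
  have h := fderiv_comp_smul (𝕜 := ℝ) (f := radialExt u) (x := x) c
  simp only [radialExt_smul u hc] at h
  apply lor_left_injective
  intro z
  rw [lor_hgrad, lor_smul_left, lor_hgrad, h, smul_apply, smul_eq_mul,
    inv_mul_cancel_left₀ hc.ne']

lemma subset_cone (A : Set (L n)) : A ⊆ cone A := fun q hq => ⟨q, hq, 1, one_pos, by simp⟩

lemma smul_mem_cone {A : Set (L n)} {x : L n} (hx : x ∈ cone A) {c : ℝ} (hc : 0 < c) :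
    c • x ∈ cone A := by
  obtain ⟨q, hq, ρ, hρ, rfl⟩ := hx
  exact ⟨q, hq, c * ρ, mul_pos hc hρ, by rw [smul_smul]⟩

lemma continuous_lor_self : Continuous fun x : L n => lor x x :=
  (lorL (n := n)).continuous₂.comp (continuous_id.prodMk continuous_id)

lemma continuous_lmod : Continuous (lmod (n := n)) :=
  Real.continuous_sqrt.comp (continuous_abs.comp continuous_lor_self)

lemma lmod_pos {x : L n} (hx : lor x x < 0) : 0 < lmod x :=
  Real.sqrt_pos.2 (abs_pos.2 hx.ne)

lemma lmod_sq_of_neg {x : L n} (hx : lor x x < 0) : lmod x ^ 2 = -lor x x := by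
  rw [lmod, Real.sq_sqrt (abs_nonneg _), abs_of_neg hx]

lemma inv_lmod_smul_mem_hyp {x : L n} (hx : lor x x < 0) (hx' : 0 < x (Fin.last n)) :
    (lmod x)⁻¹ • x ∈ hyp n := by
  have h := lmod_pos hx
  refine ⟨?_, ?_⟩
  · have h2 := lmod_sq_of_neg hx
    rw [lor_smul_left, lor_smul_right]
    field_simp
    linarith
  · rw [PiLp.smul_apply, smul_eq_mul]; positivity

lemma lor_neg_of_mem_cone {A : Set (L n)} (hA : A ⊆ hyp n) {x : L n} (hx : x ∈ cone A) :
    lor x x < 0 ∧ (lmod x)⁻¹ • x ∈ A := by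
  obtain ⟨q, hq, ρ, hρ, rfl⟩ := hx
  constructor
  · rw [lor_smul_left, lor_smul_right, (hA hq).1]; nlinarith
  · rwa [lmod_smul hρ, lmod_of_mem_hyp (hA hq), mul_one, smul_smul, inv_mul_cancel₀ hρ.ne', one_smul]

/-- On the open future cone the normalisation `x ↦ x / |x|` is continuous, and the cone over `Ω` is
the preimage of `Ω` under it. Openness makes Fréchet derivatives at points of `Ω` meaningful. -/
lemma isOpen_cone {Ω : Set (L n)} (hΩ : ∃ U : Set (L n), IsOpen U ∧ Ω = hyp n ∩ U) :
    IsOpen (cone Ω) := by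
  obtain ⟨U, hU, rfl⟩ := hΩ
  have hV : IsOpen {x : L n | lor x x < 0 ∧ 0 < x (Fin.last n)} :=
    (isOpen_lt continuous_lor_self continuous_const).inter
      (isOpen_lt continuous_const (EuclideanSpace.proj (𝕜 := ℝ) (Fin.last n)).continuous)
  have hc : ContinuousOn (fun x : L n => (lmod x)⁻¹ • x)
      {x : L n | lor x x < 0 ∧ 0 < x (Fin.last n)} :=
    (continuous_lmod.continuousOn.inv₀ fun x hx => (lmod_pos hx.1).ne').smul continuousOn_id
  convert hc.isOpen_inter_preimage hV hU using 1
  ext x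
  constructor
  · intro hx
    obtain ⟨h1, h2⟩ := lor_neg_of_mem_cone Set.inter_subset_left hx
    refine ⟨⟨h1, ?_⟩, h2.2⟩
    have h3 := h2.1.2
    rw [PiLp.smul_apply, smul_eq_mul] at h3
    exact (pos_iff_pos_of_mul_pos h3).1 (inv_pos.2 (lmod_pos h1))
  · rintro ⟨⟨h1, h2⟩, h3⟩
    refine ⟨_, ⟨inv_lmod_smul_mem_hyp h1 h2, h3⟩, lmod x, lmod_pos h1, ?_⟩
    rw [smul_smul, mul_inv_cancel₀ (lmod_pos h1).ne', one_smul]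

/-! ### Symmetries and Euler relations for derivatives of the gradient -/

section Derivatives

variable {u : L n → ℝ} {S : Set (L n)}

lemma contDiffAt_hgrad (hS : IsOpen S) (hu : ContDiffOn ℝ 3 (radialExt u) S) {x : L n}
    (hx : x ∈ S) : ContDiffAt ℝ 2 (hgrad u) x := by
  have h : ContDiffAt ℝ 2 (fderiv ℝ (radialExt u)) x :=
    (hu.contDiffAt (hS.mem_nhds hx)).fderiv_right (m := 2) (by norm_num)
  exact (sharpL (n := n)).contDiff.contDiffAt.comp x h

lemma hasFDerivAt_hgrad (hS : IsOpen S) (hu : ContDiffOn ℝ 3 (radialExt u) S) {x : L n}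
    (hx : x ∈ S) : HasFDerivAt (hgrad u) (fderiv ℝ (hgrad u) x) x :=
  ((contDiffAt_hgrad hS hu hx).differentiableAt (by norm_num)).hasFDerivAt

lemma hasFDerivAt_fderiv_hgrad (hS : IsOpen S) (hu : ContDiffOn ℝ 3 (radialExt u) S) {x : L n}
    (hx : x ∈ S) :
    HasFDerivAt (fderiv ℝ (hgrad u)) (fderiv ℝ (fderiv ℝ (hgrad u)) x) x :=
  (((contDiffAt_hgrad hS hu hx).fderiv_right (m := 1) (by norm_num)).differentiableAt
    (by norm_num)).hasFDerivAt

lemma hasFDerivAt_radialExt (hS : IsOpen S) (hu : ContDiffOn ℝ 3 (radialExt u) S) {x : L n}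
    (hx : x ∈ S) : HasFDerivAt (radialExt u) (fderiv ℝ (radialExt u) x) x :=
  ((hu.contDiffAt (hS.mem_nhds hx)).differentiableAt (by norm_num)).hasFDerivAt

lemma hasDerivAt_smul_one (x : L n) : HasDerivAt (fun c : ℝ => c • x) x 1 := by
  simpa using (hasDerivAt_id (1 : ℝ)).smul_const x

/-- Euler's relation in degree 0: the radial extension is constant along rays. -/
lemma lor_hgrad_self (hS : IsOpen S) (hu : ContDiffOn ℝ 3 (radialExt u) S) {x : L n}
    (hx : x ∈ S) : lor (hgrad u x) x = 0 := by
  rw [lor_hgrad]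
  have h1 : HasDerivAt (fun c : ℝ => radialExt u (c • x)) (fderiv ℝ (radialExt u) x x) 1 := 
    (hasFDerivAt_radialExt hS hu hx).comp_hasDerivAt_of_eq (1 : ℝ) (hasDerivAt_smul_one x) (by simp)
  have h2 : HasDerivAt (fun c : ℝ => radialExt u (c • x)) 0 1 := by
    refine (hasDerivAt_const (1 : ℝ) (radialExt u x)).congr_of_eventuallyEq ?_
    filter_upwards [lt_mem_nhds one_pos] with c hc using radialExt_smul u hc x
  exact h1.unique h2

/-- Euler's relation in degree -1, the degree of the gradient by `hgrad_smul`. -/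
lemma fderiv_hgrad_self (hS : IsOpen S) (hu : ContDiffOn ℝ 3 (radialExt u) S) {x : L n}
    (hx : x ∈ S) : fderiv ℝ (hgrad u) x x = -hgrad u x := by
  have h1 : HasDerivAt (fun c : ℝ => hgrad u (c • x)) (fderiv ℝ (hgrad u) x x) 1 := 
    (hasFDerivAt_hgrad hS hu hx).comp_hasDerivAt_of_eq (1 : ℝ) (hasDerivAt_smul_one x) (by simp)
  have h2 : HasDerivAt (fun c : ℝ => hgrad u (c • x)) (-hgrad u x) 1 := by
    have h3 : HasDerivAt (fun c : ℝ => c⁻¹ • hgrad u x) (-hgrad u x) 1 := by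
      simpa using (hasDerivAt_inv (one_ne_zero (α := ℝ))).smul_const (hgrad u x)
    refine h3.congr_of_eventuallyEq ?_
    filter_upwards [lt_mem_nhds one_pos] with c hc using hgrad_smul u hc x
  exact h1.unique h2

lemma lor_fderiv_hgrad (hS : IsOpen S) (hu : ContDiffOn ℝ 3 (radialExt u) S) {x : L n}
    (hx : x ∈ S) (X Y : L n) :
    lor (fderiv ℝ (hgrad u) x X) Y = fderiv ℝ (fderiv ℝ (radialExt u)) x X Y := by
  have h : HasFDerivAt (fderiv ℝ (radialExt u)) (fderiv ℝ (fderiv ℝ (radialExt u)) x) x :=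
    (((hu.contDiffAt (hS.mem_nhds hx)).fderiv_right (m := 2) (by norm_num)).differentiableAt
      (by norm_num)).hasFDerivAt
  have h2 : HasFDerivAt (hgrad u) (sharpL.comp (fderiv ℝ (fderiv ℝ (radialExt u)) x)) x :=
    (sharpL (n := n)).hasFDerivAt.comp x h
  rw [h2.fderiv, ContinuousLinearMap.comp_apply, sharpL_apply, lor_sharp]

lemma fderiv_hgrad_symm (hS : IsOpen S) (hu : ContDiffOn ℝ 3 (radialExt u) S) {x : L n}
    (hx : x ∈ S) (X Y : L n) :
    lor (fderiv ℝ (hgrad u) x X) Y = lor X (fderiv ℝ (hgrad u) x Y) := by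
  rw [lor_comm X, lor_fderiv_hgrad hS hu hx, lor_fderiv_hgrad hS hu hx]
  exact (hu.contDiffAt (hS.mem_nhds hx)).isSymmSndFDerivAt
    (by simp only [minSmoothness_of_isRCLikeNormedField]; norm_num) X Y

lemma fderiv_fderiv_hgrad_symm (hS : IsOpen S) (hu : ContDiffOn ℝ 3 (radialExt u) S) {x : L n}
    (hx : x ∈ S) (X Y : L n) :
    fderiv ℝ (fderiv ℝ (hgrad u)) x X Y = fderiv ℝ (fderiv ℝ (hgrad u)) x Y X :=
  (contDiffAt_hgrad hS hu hx).isSymmSndFDerivAt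
    (by simp only [minSmoothness_of_isRCLikeNormedField]; norm_num) X Y

lemma hasDerivAt_line (x X : L n) (s : ℝ) : HasDerivAt (fun s : ℝ => x + s • X) X s := by
  simpa using ((hasDerivAt_id s).smul_const X).const_add x

lemma tendsto_line (x X : L n) : Tendsto (fun s : ℝ => x + s • X) (𝓝 0) (𝓝 x) := by
  simpa using (hasDerivAt_line x X 0).continuousAt.tendsto

lemma hasDerivAt_fderiv_hgrad_line (hS : IsOpen S) (hu : ContDiffOn ℝ 3 (radialExt u) S)
    {x : L n} (hx : x ∈ S) (X : L n) :
    HasDerivAt (fun s : ℝ => fderiv ℝ (hgrad u) (x + s • X))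
      (fderiv ℝ (fderiv ℝ (hgrad u)) x X) 0 := 
  (hasFDerivAt_fderiv_hgrad hS hu hx).comp_hasDerivAt_of_eq (0 : ℝ) (hasDerivAt_line x X 0)
    (by simp)

lemma hasDerivAt_lor {f g : ℝ → L n} {f' g' : L n} {s : ℝ} (hf : HasDerivAt f f' s)
    (hg : HasDerivAt g g' s) :
    HasDerivAt (fun s => lor (f s) (g s)) (lor f' (g s) + lor (f s) g') s := by
  have h := ((lorL (n := n)).hasFDerivAt.comp_hasDerivAt s hf).clm_apply hg
  exact h

lemma lor_fderiv_fderiv_hgrad_symm (hS : IsOpen S) (hu : ContDiffOn ℝ 3 (radialExt u) S) {x : L n}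
    (hx : x ∈ S) (X Y Z : L n) :
    lor (fderiv ℝ (fderiv ℝ (hgrad u)) x X Y) Z = lor (fderiv ℝ (fderiv ℝ (hgrad u)) x X Z) Y := by
  have h := fun Y : L n =>
    (hasDerivAt_fderiv_hgrad_line hS hu hx X).clm_apply (hasDerivAt_const (0 : ℝ) Y)
  have h1 := hasDerivAt_lor (h Y) (hasDerivAt_const (0 : ℝ) Z)
  have h2 := hasDerivAt_lor (h Z) (hasDerivAt_const (0 : ℝ) Y)
  have h3 := h1.congr_of_eventuallyEq (f₁ := fun s : ℝ => lor (fderiv ℝ (hgrad u) (x + s • X) Z) Y)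
    (by
      filter_upwards [(tendsto_line x X).eventually (hS.mem_nhds hx)] with s hs
      rw [fderiv_hgrad_symm hS hu hs, lor_comm])
  have := h3.unique h2
  simpa [← lorL_apply] using this

/-- Differentiates Euler's relation `fderiv_hgrad_self` in the direction `X`. -/
lemma fderiv_fderiv_hgrad_self (hS : IsOpen S) (hu : ContDiffOn ℝ 3 (radialExt u) S) {x : L n}
    (hx : x ∈ S) (X : L n) :
    fderiv ℝ (fderiv ℝ (hgrad u)) x X x = -(2 : ℝ) • fderiv ℝ (hgrad u) x X := by
  have h1 := (hasDerivAt_fderiv_hgrad_line hS hu hx X).clm_apply (hasDerivAt_line x X 0)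
  have h2 : HasDerivAt (fun s : ℝ => -hgrad u (x + s • X)) (-fderiv ℝ (hgrad u) x X) 0 := 
    ((hasFDerivAt_hgrad hS hu hx).comp_hasDerivAt_of_eq (0 : ℝ) (hasDerivAt_line x X 0)
      (by simp)).neg
  have h3 := h2.congr_of_eventuallyEq
    (f₁ := fun s : ℝ => fderiv ℝ (hgrad u) (x + s • X) (x + s • X))
    (by
      filter_upwards [(tendsto_line x X).eventually (hS.mem_nhds hx)] with s hs
      rw [fderiv_hgrad_self hS hu hs])
  have := h1.unique h3
  simp only [zero_smul, add_zero] at this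
  rw [eq_sub_of_add_eq this, neg_smul, two_smul]
  abel

end Derivatives

/-! ### The equation in nondivergence form and its derivative -/

section Equation

variable {u : L n → ℝ} {Ω : Set (L n)}

lemma lmod_sq_of_tangent {q : L n} (hq : q ∈ hyp n) {X : L n} (hX : lor X q = 0) :
    lmod X ^ 2 = lor X X := by
  rw [lmod, Real.sq_sqrt (abs_nonneg _), abs_of_nonneg (lor_self_nonneg_of_tangent q hq X hX)]

lemma lor_lt_one_of_lmod_lt_one {q : L n} (hq : q ∈ hyp n) {X : L n} (hX : lor X q = 0)
    (h : lmod X < 1) : lor X X < 1 := by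
  rw [← lmod_sq_of_tangent hq hX]
  exact pow_lt_one₀ (Real.sqrt_nonneg _) h two_ne_zero

lemma nu_of_tangent {q : L n} (hq : q ∈ hyp n) {X : L n} (hX : lor X q = 0) :
    nu X = (Real.sqrt (1 - lor X X))⁻¹ := by
  rw [nu, lmod_sq_of_tangent hq hX, one_div]

/-- The normalisation of `x` is absorbed by homogeneity, giving an explicit expression near `q` to
which the product rule applies. -/
lemma radialExt_nu_smul_hgrad (hΩ : Ω ⊆ hyp n) (hS : IsOpen (cone Ω))
    (hu : ContDiffOn ℝ 3 (radialExt u) (cone Ω)) {x : L n} (hx : x ∈ cone Ω) :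
    radialExt (fun p => nu (hgrad u p) • hgrad u p) x =
      (Real.sqrt (-lor x x) *
        (Real.sqrt (1 + lor x x * lor (hgrad u x) (hgrad u x)))⁻¹) • hgrad u x := by
  obtain ⟨h1, h2⟩ := lor_neg_of_mem_cone hΩ hx
  have h3 := lmod_pos h1
  have h4 : hgrad u ((lmod x)⁻¹ • x) = lmod x • hgrad u x := by
    rw [hgrad_smul u (inv_pos.2 h3), inv_inv]
  have h5 := lor_hgrad_self hS hu (subset_cone Ω h2)
  rw [radialExt, nu_of_tangent (hΩ h2) h5, h4, smul_smul, lor_smul_left, lor_smul_right, ← mul_assoc,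
    ← sq, lmod_sq_of_neg h1, mul_comm]
  congr 2
  · rw [lmod, abs_of_neg h1]
  · congr 2; ring

lemma differentiableAt_lor {f g : L n → L n} {f' g' : L n →L[ℝ] L n} {x : L n}
    (hf : HasFDerivAt f f' x) (hg : HasFDerivAt g g' x) :
    DifferentiableAt ℝ (fun y => lor (f y) (g y)) x :=
  (((lorL (n := n)).hasFDerivAt.comp x hf).clm_apply hg).differentiableAt

/-- The product rule for `c ∇u`, with `c` the coefficient in `radialExt_nu_smul_hgrad`. The
correction from the tangential projection vanishes, so the divergence is the flat trace. -/
lemma hdiv_nu_smul_hgrad (hΩ : Ω ⊆ hyp n) (hS : IsOpen (cone Ω))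
    (hu : ContDiffOn ℝ 3 (radialExt u) (cone Ω)) {q : L n} (hq : q ∈ Ω)
    (hw : lor (hgrad u q) (hgrad u q) < 1) :
    hdiv (fun p => nu (hgrad u p) • hgrad u p) q =
      nu (hgrad u q) * tr (fderiv ℝ (hgrad u) q) +
      nu (hgrad u q) ^ 3 * lor (fderiv ℝ (hgrad u) q (hgrad u q)) (hgrad u q) := by
  have hqS := subset_cone Ω hq
  have hqq := (hΩ hq).1
  have hpq := lor_hgrad_self hS hu hqS
  set p := hgrad u q with hp
  set A := fderiv ℝ (hgrad u) q with hA
  have hAq : A q = -p := fderiv_hgrad_self hS hu hqS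
  have hP : HasFDerivAt (hgrad u) A q := hasFDerivAt_hgrad hS hu hqS
  set c : L n → ℝ := fun x => Real.sqrt (-lor x x) *
        (Real.sqrt (1 + lor x x * lor (hgrad u x) (hgrad u x)))⁻¹ with hc
  have hw' : 0 < 1 - lor p p := by linarith
  have hcq : c q = nu p := by
    rw [nu_of_tangent (hΩ hq) hpq]
    simp only [hc, hqq, ← hp]
    norm_num [sub_eq_add_neg]
  have hcd : DifferentiableAt ℝ c q := by
    have h1 := differentiableAt_lor (hasFDerivAt_id q) (hasFDerivAt_id q)
    have h2 := differentiableAt_lor hP hP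
    refine (h1.neg.sqrt (by simp [hqq])).mul ((((h1.mul h2).const_add 1).sqrt ?_).inv ?_)
    · simp only [id, Pi.mul_apply, hqq, ← hp]; linarith
    · refine (Real.sqrt_pos.2 ?_).ne'
      simp only [id, Pi.mul_apply, hqq, ← hp]; linarith
  have hcp : fderiv ℝ c q p = nu p ^ 3 * lor (A p) p := by
    have h1 : HasDerivAt (fun s : ℝ => c (q + s • p)) (fderiv ℝ c q p) 0 :=
      hcd.hasFDerivAt.comp_hasDerivAt_of_eq 0 (hasDerivAt_line q p 0) (by simp)
    have hl := hasDerivAt_line q p 0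
    have hPl : HasDerivAt (fun s : ℝ => hgrad u (q + s • p)) (A p) 0 :=
      hP.comp_hasDerivAt_of_eq 0 hl (by simp)
    have hσ := hasDerivAt_lor hl hl
    have hG := hasDerivAt_lor hPl hPl
    have h2 := (hσ.neg.sqrt (by simp [hqq])).mul ((((hσ.mul hG).const_add 1).sqrt
      (by simp [hqq, ← hp]; linarith)).inv (by
        refine (Real.sqrt_pos.2 ?_).ne'; simp [hqq, ← hp]; linarith))
    rw [h1.unique h2, nu_of_tangent (hΩ hq) hpq]
    simp only [zero_smul, add_zero, hqq, ← hp, lor_comm q p, hpq, Pi.neg_apply, Pi.mul_apply,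
      Pi.inv_apply]
    have e1 : (1 : ℝ) + -1 * lor p p = 1 - lor p p := by ring
    have h4 := Real.sqrt_pos.2 hw'
    rw [e1, lor_comm p (A p)]
    norm_num
    field_simp
    ring
  have hM : HasFDerivAt (radialExt (fun p => nu (hgrad u p) • hgrad u p))
      (c q • A + (fderiv ℝ c q).smulRight p) q := by
    refine (hcd.hasFDerivAt.smul hP).congr_of_eventuallyEq ?_
    filter_upwards [hS.mem_nhds hqS] with x hx
    exact radialExt_nu_smul_hgrad hΩ hS hu hx
  have htr : ∀ M : L n →L[ℝ] L n,
      ∑ i, tangentProj q (M (EuclideanSpace.single i 1)) i = tr M + lor (M q) q := by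
    intro M
    simp only [tangentProj, PiLp.add_apply, PiLp.smul_apply, smul_eq_mul, Finset.sum_add_distrib]
    rw [tr]
    congr 1
    conv_rhs => rw [← sum_single q, map_sum]
    rw [sum_single q, ← lorL_apply, map_sum, sum_apply]
    refine Finset.sum_congr rfl fun i _ => ?_
    rw [map_smul, map_smul, smul_apply, lorL_apply, smul_eq_mul, mul_comm]
  rw [hdiv]
  simp only [covDeriv]
  rw [htr, hM.fderiv]
  have e2 : lor ((c q • A + (fderiv ℝ c q).smulRight p) q) q = 0 := by
    rw [add_apply, smul_apply, ContinuousLinearMap.smulRight_apply, hAq, lor_add_left, lor_smul_left,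
      lor_smul_left, lor_neg_left, hpq]
    ring
  have e3 : tr (c q • A + (fderiv ℝ c q).smulRight p) = c q * tr A + fderiv ℝ c q p := by
    simp only [tr, add_apply, smul_apply, ContinuousLinearMap.smulRight_apply, PiLp.add_apply,
      PiLp.smul_apply, smul_eq_mul, Finset.sum_add_distrib, ← Finset.mul_sum]
    congr 1
    conv_rhs => rw [← sum_single p, map_sum]
    refine Finset.sum_congr rfl fun i _ => ?_
    rw [map_smul, smul_eq_mul, mul_comm]
  rw [e2, e3, hcp, hcq, add_zero]

/-- The equation in nondivergence form. -/
lemma IsSolution.trace_eq {H : L n → ℝ} {t : ℝ} (hsol : IsSolution Ω H t u) (hΩ : Ω ⊆ hyp n)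
    (hS : IsOpen (cone Ω)) (hu : ContDiffOn ℝ 3 (radialExt u) (cone Ω)) {q : L n} (hq : q ∈ Ω) :
    tr (fderiv ℝ (hgrad u) q) + (1 - lor (hgrad u q) (hgrad u q))⁻¹ *
        lor (fderiv ℝ (hgrad u) q (hgrad u q)) (hgrad u q) =
      n * t * (1 - Real.exp (radialExt u q) * H (Real.exp (radialExt u q) • q) *
        Real.sqrt (1 - lor (hgrad u q) (hgrad u q))) := by
  have hpq := lor_hgrad_self hS hu (subset_cone Ω hq)
  have hw := lor_lt_one_of_lmod_lt_one (hΩ hq) hpq (hsol.spacelike q hq)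
  have h := hsol.eqn q hq
  rw [hdiv_nu_smul_hgrad hΩ hS hu hq hw, nu_of_tangent (hΩ hq) hpq] at h
  rw [radialExt_of_mem_hyp u (hΩ hq)]
  have hR := Real.sqrt_pos.2 (sub_pos.2 hw)
  have hR2 := Real.sq_sqrt (sub_pos.2 hw).le
  rw [← hR2]
  rw [Real.sqrt_sq hR.le]
  set R := Real.sqrt (1 - lor (hgrad u q) (hgrad u q))
  field_simp at h ⊢
  linear_combination -h

/-- The trace as a continuous linear form. -/
def trL : (L n →L[ℝ] L n) →L[ℝ] ℝ :=
  LinearMap.toContinuousLinearMap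
    { toFun := tr
      map_add' := fun M M' => by simp [tr, Finset.sum_add_distrib]
      map_smul' := fun c M => by simp [tr, Finset.mul_sum] }

lemma trL_apply (M : L n →L[ℝ] L n) : trL M = tr M := rfl

/-- The equation in nondivergence form, differentiated in the direction of the gradient. -/
lemma IsSolution.deriv_trace_eq {H : L n → ℝ} {t : ℝ} (hsol : IsSolution Ω H t u)
    (hΩo : ∃ U : Set (L n), IsOpen U ∧ Ω = hyp n ∩ U)
    (hu : ContDiffOn ℝ 3 (radialExt u) (cone Ω)) (hH : DifferentiableOn ℝ H (cone Ω))
    {q p : L n} (hq : q ∈ Ω) (hp : hgrad u q = p) {A : L n →L[ℝ] L n}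
    (hA : fderiv ℝ (hgrad u) q = A) {N a : ℝ} (hN : nu p = N) (ha : Real.exp (radialExt u q) = a) :
    tr (fderiv ℝ (fderiv ℝ (hgrad u)) q p) +
        N ^ 2 * (lor (fderiv ℝ (fderiv ℝ (hgrad u)) q p p) p + 2 * lor (A p) (A p)) +
        2 * N ^ 4 * lor (A p) p ^ 2 =
      -(n * t * ((a * lor p p * H (a • q) +
        a * fderiv ℝ H (a • q) ((a * lor p p) • q + a • p)) / N -
          a * H (a • q) * lor (A p) p * N)) := by
  have hΩ : Ω ⊆ hyp n := by obtain ⟨U, _, rfl⟩ := hΩo; exact Set.inter_subset_left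
  have hS := isOpen_cone hΩo
  have hqS := subset_cone Ω hq
  have hqq := (hΩ hq).1
  have hpq : lor p q = 0 := by rw [← hp]; exact lor_hgrad_self hS hu hqS
  have hw : lor p p < 1 := by
    rw [← hp] at hpq ⊢
    exact lor_lt_one_of_lmod_lt_one (hΩ hq) hpq (hsol.spacelike q hq)
  have hw0 := lor_self_nonneg_of_tangent q (hΩ hq) p hpq
  set w := lor p p with hwdef
  -- The equation holds only on `Ω`, not on the cone, so it is differentiated along a curve inside
  -- the hyperboloid with velocity `p` at `q`.
  set γ : ℝ → L n := fun s => Real.sqrt (1 + s ^ 2 * w) • q + s • p with hγ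
  have hγ0 : γ 0 = q := by simp [hγ]
  have hγ' : HasDerivAt γ p 0 := by
    have h1 : HasDerivAt (fun s : ℝ => Real.sqrt (1 + s ^ 2 * w)) 0 0 := by
      have := ((((hasDerivAt_id (0 : ℝ)).pow 2).mul_const w).const_add 1).sqrt (by simp)
      simpa using this
    have h2 := (h1.smul_const q).add ((hasDerivAt_id (0 : ℝ)).smul_const p)
    rw [zero_smul, one_smul, zero_add] at h2
    exact h2
  have hγΩ : ∀ᶠ s in 𝓝 0, γ s ∈ Ω := by
    obtain ⟨U, hU, rfl⟩ := hΩo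
    have hcont : Tendsto γ (𝓝 0) (𝓝 q) := by
      have := hγ'.continuousAt.tendsto; rwa [hγ0] at this
    have hlast : Tendsto (fun s => γ s (Fin.last n)) (𝓝 0) (𝓝 (q (Fin.last n))) :=
      ((EuclideanSpace.proj (𝕜 := ℝ) (Fin.last n)).continuous.tendsto q).comp hcont
    filter_upwards [hcont.eventually (hU.mem_nhds hq.2), hlast.eventually (lt_mem_nhds hq.1.2)]
      with s h1 h2
    refine ⟨⟨?_, h2⟩, h1⟩
    have h3 : 0 ≤ 1 + s ^ 2 * w := by positivity
    simp only [hγ, lor_add_left, lor_add_right, lor_smul_left, lor_smul_right, hqq, hpq,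
      lor_comm q p, ← hwdef]
    linear_combination -Real.sq_sqrt h3
  have hPγ : HasDerivAt (fun s => hgrad u (γ s)) (A p) 0 := by
    rw [← hA]
    exact (hasFDerivAt_hgrad hS hu hqS).comp_hasDerivAt_of_eq 0 hγ' hγ0.symm
  have hAγ := (hasFDerivAt_fderiv_hgrad hS hu hqS).comp_hasDerivAt_of_eq 0 hγ' hγ0.symm
  have hUγ : HasDerivAt (fun s => radialExt u (γ s)) w 0 := by
    have := (hasFDerivAt_radialExt hS hu hqS).comp_hasDerivAt_of_eq 0 hγ' hγ0.symm
    rwa [← lor_hgrad, hp] at this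
  have hEγ := hUγ.exp
  have ha0 : 0 < a := ha ▸ Real.exp_pos _
  have hHγ : HasDerivAt (fun s => H (Real.exp (radialExt u (γ s)) • γ s))
      (fderiv ℝ H (a • q) ((a * w) • q + a • p)) 0 := by
    have h1 : HasFDerivAt H (fderiv ℝ H (a • q)) (a • q) :=
      ((hH _ (smul_mem_cone hqS ha0)).differentiableAt
        (hS.mem_nhds (smul_mem_cone hqS ha0))).hasFDerivAt
    have h2 := h1.comp_hasDerivAt_of_eq 0 (hEγ.smul hγ') (by simp [hγ0, ha])
    rw [hγ0, ha] at h2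
    rw [add_comm ((a * w) • q)]
    exact h2
  have hGγ := hasDerivAt_lor hPγ hPγ
  have hw1 : 1 - lor (hgrad u (γ 0)) (hgrad u (γ 0)) ≠ 0 := by
    rw [hγ0, hp, ← hwdef]; linarith
  have hl := (((trL (n := n)).hasFDerivAt.comp_hasDerivAt 0 hAγ)).add
    (((hGγ.const_sub 1).inv hw1).mul (hasDerivAt_lor (hAγ.clm_apply hPγ) hPγ))
  have hr := (((hEγ.mul hHγ).mul ((hGγ.const_sub 1).sqrt hw1)).const_sub 1).const_mul (n * t : ℝ)
  have hr' := hr.congr_of_eventuallyEq (by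
    filter_upwards [hγΩ] with s hs
    exact hsol.trace_eq hΩ hS hu hs)
  have h := hl.unique hr'
  simp only [trL_apply, Function.comp_apply, Pi.inv_apply, Pi.mul_apply, hγ0, hp, hA, ha, ← hwdef, lor_add_left] at h
  -- Symmetry of `A` gives `⟨A (A p), p⟩ = ⟨A p, A p⟩`, whence the factor 2 in the conclusion.
  have hsymm := fderiv_hgrad_symm hS hu hqS (A p) p
  rw [hA] at hsymm
  rw [hsymm, lor_comm p (A p)] at h
  have hR := Real.sqrt_pos.2 (sub_pos.2 hw)
  have hR2 := Real.sq_sqrt (sub_pos.2 hw).le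
  rw [nu_of_tangent (hΩ hq) hpq, ← hwdef] at hN
  rw [← hN]
  rw [← hR2, Real.sqrt_sq hR.le] at h
  set R := Real.sqrt (1 - w)
  field_simp at h ⊢
  linear_combination h / 2

end Equation

/-! ### Interior maxima of the auxiliary function -/

/-- The necessary conditions of first and second order at a local maximum. -/
lemma second_order_of_isLocalMax {φ φ' : ℝ → ℝ} {c : ℝ} (hmax : IsLocalMax φ 0)
    (h1 : ∀ᶠ s in 𝓝 0, HasDerivAt φ (φ' s) s) (h2 : HasDerivAt φ' c 0) : φ' 0 = 0 ∧ c ≤ 0 := by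
  have h0 : φ' 0 = 0 := hmax.hasDerivAt_eq_zero h1.self_of_nhds
  refine ⟨h0, ?_⟩
  by_contra! hc
  have hd : deriv φ =ᶠ[𝓝 0] φ' := by filter_upwards [h1] with s hs using hs.deriv
  have hdd : deriv (deriv φ) 0 = c := by rw [hd.deriv_eq, h2.deriv]
  -- If `c > 0`, the point is also a local minimum, so `φ` is locally constant and its second
  -- derivative is zero.
  have hmin : IsLocalMin φ 0 := isLocalMin_of_deriv_deriv_pos (by rw [hdd]; exact hc)
    (by rw [hd.self_of_nhds, h0]) h1.self_of_nhds.continuousAt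
  have hconst : φ =ᶠ[𝓝 0] fun _ => φ 0 := by
    filter_upwards [hmax, hmin] with s hs hs' using le_antisymm hs hs'
  have : deriv (deriv φ) 0 = 0 := by
    rw [hconst.deriv.deriv_eq]
    simp
  linarith

section Maximum

variable {u : L n → ℝ} {Ω : Set (L n)}

/-- The auxiliary function `log ν + (n / 2) u²`, extended to the cone by homogeneity. -/
def aux (u : L n → ℝ) (x : L n) : ℝ :=
  -(1 / 2) * Real.log (1 + lor x x * lor (hgrad u x) (hgrad u x)) + n / 2 * radialExt u x ^ 2

lemma aux_smul (u : L n → ℝ) {c : ℝ} (hc : 0 < c) (x : L n) : aux u (c • x) = aux u x := by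
  rw [aux, aux, hgrad_smul u hc, radialExt_smul u hc]
  simp only [lor_smul_left, lor_smul_right]
  congr 4
  field_simp

/-- The function `aux u` is differentiated twice along the line `q + sX`. The line leaves the
hyperboloid, but the maximum is taken in the ambient space. The factor `⟨x, x⟩` is stationary at `q`
in the direction `X`, and its second derivative produces the term `-⟨X, X⟩⟨p, p⟩`. -/
lemma second_order_of_isLocalMax_aux (hΩ : Ω ⊆ hyp n) (hS : IsOpen (cone Ω))
    (hu : ContDiffOn ℝ 3 (radialExt u) (cone Ω)) {q p : L n} (hq : q ∈ Ω) (hp : hgrad u q = p)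
    {A : L n →L[ℝ] L n} (hA : fderiv ℝ (hgrad u) q = A) (hw : lor p p < 1)
    (hmax : IsLocalMax (aux u) q) {N : ℝ} (hN : N ^ 2 * (1 - lor p p) = 1) {X : L n}
    (hX : lor X q = 0) :
    N ^ 2 * lor (A X) p + n * radialExt u q * lor p X = 0 ∧
    N ^ 2 * (-lor X X * lor p p + lor (A X) (A X) +
        lor (fderiv ℝ (fderiv ℝ (hgrad u)) q X X) p) +
      2 * N ^ 4 * lor (A X) p ^ 2 + n * radialExt u q * lor (A X) X + n * lor p X ^ 2 ≤ 0 := by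
  have hqS := subset_cone Ω hq
  have hqq := (hΩ hq).1
  have hXq : lor q X = 0 := by rw [lor_comm, hX]
  have hD0 : (0 : ℝ) < 1 + lor q q * lor (hgrad u q) (hgrad u q) := by rw [hqq, hp]; linarith
  have hS0 : ∀ᶠ s : ℝ in 𝓝 0, q + s • X ∈ cone Ω :=
    (tendsto_line q X).eventually (hS.mem_nhds hqS)
  have hPl : ∀ s : ℝ, q + s • X ∈ cone Ω → HasDerivAt (fun s : ℝ => hgrad u (q + s • X))
      (fderiv ℝ (hgrad u) (q + s • X) X) s := fun s hs =>
    (hasFDerivAt_hgrad hS hu hs).comp_hasDerivAt_of_eq s (hasDerivAt_line q X s) rfl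
  have hUl : ∀ s : ℝ, q + s • X ∈ cone Ω → HasDerivAt (fun s : ℝ => radialExt u (q + s • X))
      (lor (hgrad u (q + s • X)) X) s := fun s hs => by
    rw [lor_hgrad]
    exact (hasFDerivAt_radialExt hS hu hs).comp_hasDerivAt_of_eq s (hasDerivAt_line q X s) rfl
  have hq0 : q + (0 : ℝ) • X ∈ cone Ω := by simpa using hqS
  have hDl : ∀ s : ℝ, q + s • X ∈ cone Ω → HasDerivAt (fun s : ℝ => 1 + lor (q + s • X) (q + s • X) *
      lor (hgrad u (q + s • X)) (hgrad u (q + s • X))) _ s := fun s hs =>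
    ((hasDerivAt_lor (hasDerivAt_line q X s) (hasDerivAt_line q X s)).mul
      (hasDerivAt_lor (hPl s hs) (hPl s hs))).const_add 1
  have hDpos : ∀ᶠ s : ℝ in 𝓝 0, (0 : ℝ) < 1 + lor (q + s • X) (q + s • X) *
      lor (hgrad u (q + s • X)) (hgrad u (q + s • X)) :=
    (hDl 0 hq0).continuousAt.eventually (lt_mem_nhds (by simpa using hD0))
  have hmax' : IsLocalMax (fun s : ℝ => aux u (q + s • X)) 0 := by
    have := (tendsto_line q X).eventually hmax
    filter_upwards [this] with s hs
    simpa using hs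
  have hAl := (hasDerivAt_fderiv_hgrad_line hS hu hqS X).clm_apply (hasDerivAt_const (0 : ℝ) X)
  have hl0 := hasDerivAt_line q X 0
  have hP0 := hPl 0 hq0
  have hX0 := hasDerivAt_const (0 : ℝ) X
  have key := second_order_of_isLocalMax hmax'
    (by
      filter_upwards [hS0, hDpos] with s hs hs'
      exact (((hDl s hs).log hs'.ne').const_mul (-(1 / 2) : ℝ)).add
        (((hUl s hs).pow 2).const_mul (n / 2 : ℝ)))
    (((((((hasDerivAt_lor hX0 hl0).add (hasDerivAt_lor hl0 hX0)).mul (hasDerivAt_lor hP0 hP0)).add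
      ((hasDerivAt_lor hl0 hl0).mul ((hasDerivAt_lor hAl hP0).add (hasDerivAt_lor hP0 hAl)))).div
      (hDl 0 hq0) (by simpa using hD0.ne')).const_mul (-(1 / 2) : ℝ)).add
      (((((hUl 0 hq0).pow 1).const_mul (2 : ℝ)).mul (hasDerivAt_lor hP0 hX0)).const_mul (n / 2 : ℝ)))
  obtain ⟨k1, k2⟩ := key
  have hz : ∀ Y : L n, lor 0 Y = 0 := fun Y => by simp [← lorL_apply]
  have hz' : ∀ Y : L n, lor Y 0 = 0 := fun Y => by simp [← lorL_apply]
  simp only [Pi.add_apply, Pi.mul_apply, Pi.pow_apply, Pi.div_apply, zero_smul, add_zero, hp, hA, hqq, hX, hXq,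
    hz, hz', map_zero, lor_comm p (A X), lor_comm p (_ : L n)] at k1 k2
  have hD : (0 : ℝ) < 1 - lor p p := by linarith
  have hN2 : N ^ 2 = (1 - lor p p)⁻¹ := eq_inv_of_mul_eq_one_left hN
  have hN4 : N ^ 4 = ((1 - lor p p)⁻¹) ^ 2 := by rw [← hN2]; ring
  rw [hN2, hN4, lor_comm p X]
  have e1 : (1 : ℝ) + -1 * lor p p = 1 - lor p p := by ring
  rw [e1] at k1 k2
  constructor
  · rw [← k1]
    field_simp
    ring
  · refine le_trans (le_of_eq ?_) k2
    simp only [Nat.sub_self, pow_zero, Nat.cast_one]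
    field_simp
    ring

/-- The bound for `ν` at an interior maximum of the auxiliary function. -/
lemma nu_le_of_isLocalMax_aux (hΩo : ∃ U : Set (L n), IsOpen U ∧ Ω = hyp n ∩ U) {H : L n → ℝ}
    {t : ℝ} (ht : t ∈ Set.Icc (0 : ℝ) 1) (hsol : IsSolution Ω H t u)
    (hu : ContDiffOn ℝ 3 (radialExt u) (cone Ω)) (hH : DifferentiableOn ℝ H (cone Ω))
    {q p : L n} (hq : q ∈ Ω) (hp : hgrad u q = p) (hmax : IsLocalMax (aux u) q) {a M B B' : ℝ}
    (ha : Real.exp (radialExt u q) = a) (hM : |radialExt u q| ≤ M) (hB : |a * H (a • q)| ≤ B)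
    (hB' : |a * lor p p * H (a • q) + a * fderiv ℝ H (a • q) ((a * lor p p) • q + a • p)| ≤ B') :
    nu p ≤ 1 + n * (B' + B * (n * M)) + n * M * (n * (1 + B)) := by
  have hΩ : Ω ⊆ hyp n := by obtain ⟨U, _, rfl⟩ := hΩo; exact Set.inter_subset_left
  have hS := isOpen_cone hΩo
  have hqS := subset_cone Ω hq
  have hpq : lor p q = 0 := by rw [← hp]; exact lor_hgrad_self hS hu hqS
  have hw : lor p p < 1 := by
    rw [← hp] at hpq ⊢
    exact lor_lt_one_of_lmod_lt_one (hΩ hq) hpq (hsol.spacelike q hq)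
  have hw0 := lor_self_nonneg_of_tangent q (hΩ hq) p hpq
  have hnu := nu_of_tangent (hΩ hq) hpq
  have hR := Real.sqrt_pos.2 (sub_pos.2 hw)
  have hR2 := Real.sq_sqrt (sub_pos.2 hw).le
  have hR1 : Real.sqrt (1 - lor p p) ≤ 1 := Real.sqrt_le_one.2 (by linarith)
  have hN : nu p ^ 2 * (1 - lor p p) = 1 := by
    rw [hnu, ← hR2, Real.sqrt_sq hR.le]
    field_simp
  have hN1 : 1 ≤ nu p := by rw [hnu]; exact (one_le_inv₀ hR).2 hR1
  have hso := fun X (hX : lor X q = 0) =>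
    second_order_of_isLocalMax_aux hΩ hS hu hq hp rfl hw hmax hN hX
  have e0 := hsol.trace_eq hΩ hS hu hq
  have e1 := hsol.deriv_trace_eq hΩo hu hH hq hp rfl rfl ha
  have hNR : Real.sqrt (1 - lor p p) = (nu p)⁻¹ := by rw [hnu, inv_inv]
  rw [hp, ha, hNR, ← eq_inv_of_mul_eq_one_left hN] at e0
  have key := bernstein_pointwise q (hΩ hq) p (fderiv ℝ (hgrad u) q)
    (fderiv ℝ (fderiv ℝ (hgrad u)) q) hpq (fderiv_hgrad_symm hS hu hqS)
    (fderiv_fderiv_hgrad_symm hS hu hqS) (lor_fderiv_fderiv_hgrad_symm hS hu hqS)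
    (by rw [fderiv_hgrad_self hS hu hqS, hp]) (fderiv_fderiv_hgrad_self hS hu hqS) (nu p) _ n _ _
    hN (fun X hX => (hso X hX).1) (fun X hX => (hso X hX).2) e0 e1
  have hg := (hso p hpq).1
  clear e0 e1 hso hmax hnu hR hR2 hR1 hNR
  generalize nu p = N at *
  generalize lor (fderiv ℝ (hgrad u) q p) p = g at *
  generalize a * lor p p * H (a • q) + a * fderiv ℝ H (a • q) ((a * lor p p) • q + a • p) = h' at *
  generalize a * H (a • q) = h at *
  generalize radialExt u q = v at *
  generalize lor p p = w at *
  have hN0 : 0 < N := by linarith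
  have hn0 : (0 : ℝ) ≤ n := Nat.cast_nonneg n
  have hM0 : 0 ≤ M := (abs_nonneg _).trans hM
  have hB0 : 0 ≤ B := (abs_nonneg _).trans hB
  have hB0' : 0 ≤ B' := (abs_nonneg _).trans hB'
  -- The first-order condition `N² g = -n v w` lowers the term `N³ h g` to order `N`. On the left,
  -- `(n - (n - 1)) w N² = N² - 1`.
  have key' : N ^ 2 - 1 ≤ n * t * (N * (h' + h * (n * v) * w)) + -(n * v) * (n * t * (1 - h * N⁻¹)) := by
    have e2 : N ^ 2 * -(n * t * (h' / N - h * g * N)) =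
        -(n * t * (N * (h' + h * (n * v) * w))) := by
      field_simp
      linear_combination n * t * h * hg
    rw [e2] at key
    linear_combination key + hN
  have b1 : h' + h * (n * v) * w ≤ B' + B * (n * M) := by
    refine add_le_add ((le_abs_self _).trans hB') ?_
    refine (le_abs_self _).trans ?_
    rw [abs_mul, abs_mul, abs_mul, abs_of_nonneg hw0, abs_of_nonneg hn0]
    calc |h| * (n * |v|) * w ≤ B * (n * M) * 1 := by gcongr
      _ = B * (n * M) := mul_one _
  have b2 : n * t * (N * (h' + h * (n * v) * w)) ≤ n * 1 * (N * (B' + B * (n * M))) := by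
    have := ht.1
    have := ht.2
    have hK : 0 ≤ N * (B' + B * (n * M)) := by positivity
    calc n * t * (N * (h' + h * (n * v) * w)) ≤ n * t * (N * (B' + B * (n * M))) := by gcongr
      _ ≤ n * 1 * (N * (B' + B * (n * M))) := by gcongr
  have b3 : -(n * v) * (n * t * (1 - h * N⁻¹)) ≤ n * M * (n * 1 * (1 + B)) := by
    refine (le_abs_self _).trans ?_
    rw [abs_mul, abs_neg, abs_mul, abs_mul, abs_mul, abs_of_nonneg hn0, abs_of_nonneg ht.1]
    have b4 : |1 - h * N⁻¹| ≤ 1 + B := by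
      refine (abs_sub _ _).trans ?_
      rw [abs_one, abs_mul, abs_of_pos (inv_pos.2 hN0)]
      have : |h| * N⁻¹ ≤ B * 1 := by gcongr; exact inv_le_one_of_one_le₀ hN1
      linarith
    have := ht.1
    have := ht.2
    gcongr
  have hK2 : 0 ≤ n * M * (n * (1 + B)) := by positivity
  -- Since `N ≥ 1`, the terms of order zero are bounded by their multiples by `N`, and one factor
  -- `N` cancels.
  have hfin : N * N ≤ (1 + n * (B' + B * (n * M)) + n * M * (n * (1 + B))) * N := by nlinarith
  exact le_of_mul_le_mul_right hfin hN0

end Maximum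

/-! ### Euclidean bounds, compactness and boundary values of the gradient -/

lemma norm_sq_eq_lor (x : L n) : ‖x‖ ^ 2 = lor x x + 2 * x (Fin.last n) ^ 2 := by
  rw [EuclideanSpace.real_norm_sq_eq, Fin.sum_univ_castSucc, lor]
  simp only [← sq]
  ring

/-- Cauchy–Schwarz for the first `n` coordinates, with the last coordinate added back to the Lorentz
products. -/
lemma lor_add_mul_sq_le (x y : L n) :
    (lor x y + x (Fin.last n) * y (Fin.last n)) ^ 2 ≤
      (lor x x + x (Fin.last n) ^ 2) * (lor y y + y (Fin.last n) ^ 2) := by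
  have h := Finset.sum_mul_sq_le_sq_mul_sq Finset.univ (fun i : Fin n => x i.castSucc)
    (fun i : Fin n => y i.castSucc)
  simp only [lor, ← sq]
  simpa using h

lemma one_le_last_of_mem_hyp {q : L n} (hq : q ∈ hyp n) : 1 ≤ q (Fin.last n) := by
  have h := sum_sq_castSucc q hq
  have h2 : 0 ≤ ∑ i : Fin n, q i.castSucc ^ 2 := Finset.sum_nonneg fun _ _ => sq_nonneg _
  nlinarith [hq.2]

/-- A tangent vector of length at most one is bounded in terms of its base point. -/
lemma norm_le_of_tangent {q p : L n} (hq : q ∈ hyp n) (hpq : lor p q = 0) (hp : lor p p ≤ 1) :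
    ‖p‖ ≤ 1 + 2 * ‖q‖ := by
  have h := lor_add_mul_sq_le p q
  have h1 := norm_sq_eq_lor q
  have h2 := norm_sq_eq_lor p
  have h0 := lor_self_nonneg_of_tangent q hq p hpq
  rw [hq.1] at h h1
  rw [hpq] at h
  have h3 := one_le_last_of_mem_hyp hq
  set τ := q (Fin.last n)
  set σ := p (Fin.last n)
  have h5 : 1 ≤ τ ^ 2 := one_le_pow₀ h3
  have h4 : σ ^ 2 ≤ τ ^ 2 - 1 := by
    linear_combination h + mul_nonneg (sub_nonneg.2 hp) (sub_nonneg.2 h5)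
  refine abs_le_of_sq_le_sq' ?_ (by positivity) |>.2
  nlinarith [norm_nonneg q]

lemma isClosed_hyp : IsClosed (hyp n) := by
  have h : hyp n = {x | lor x x = -1} ∩ {x | 0 ≤ x (Fin.last n)} := by
    ext x
    refine ⟨fun h => ⟨h.1, h.2.le⟩, fun h => ⟨h.1, lt_of_le_of_ne h.2 fun h0 => ?_⟩⟩
    have h1 : lor x x = -1 := h.1
    have h2 : 0 ≤ ∑ i : Fin n, x i.castSucc * x i.castSucc :=
      Finset.sum_nonneg fun _ _ => mul_self_nonneg _
    rw [lor, ← h0] at h1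
    linarith
  rw [h]
  exact (isClosed_eq continuous_lor_self continuous_const).inter
    (isClosed_le continuous_const (EuclideanSpace.proj (𝕜 := ℝ) (Fin.last n)).continuous)

section Domain

variable {Ω : Set (L n)}

lemma IsBoundedDomain.subset_hyp (hΩ : IsBoundedDomain Ω) : Ω ⊆ hyp n := by
  obtain ⟨U, _, rfl⟩ := hΩ.isOpen
  exact Set.inter_subset_left

lemma IsBoundedDomain.closure_subset_hyp (hΩ : IsBoundedDomain Ω) : closure Ω ⊆ hyp n :=
  closure_minimal hΩ.subset_hyp isClosed_hyp

lemma IsBoundedDomain.isCompact_closure (hΩ : IsBoundedDomain Ω) : IsCompact (closure Ω) := by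
  refine Bornology.IsBounded.isCompact_closure ?_
  obtain ⟨p, hp⟩ := hΩ.isConnected.nonempty
  obtain ⟨R, hR⟩ := hΩ.bounded
  refine isBounded_iff_forall_norm_le.2 ⟨4 * (p (Fin.last n) * Real.cosh R), fun q hq => ?_⟩
  -- `Real.cosh_arcosh` needs an argument at least 1; below 1 the bound is immediate from `1 ≤ cosh
  -- R`.
  have hb : -lor p q ≤ Real.cosh R := by
    rcases le_or_gt 1 (-lor p q) with h | h
    · have h1 := hR p hp q hq
      rw [hdist] at h1
      have h2 := Real.arcosh_nonneg h
      rw [← Real.cosh_arcosh h, Real.cosh_le_cosh, abs_of_nonneg h2]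
      exact h1.trans (le_abs_self R)
    · exact h.le.trans (Real.one_le_cosh R)
  have hpH := hΩ.subset_hyp hp
  have hqH := hΩ.subset_hyp hq
  have h := lor_add_mul_sq_le p q
  have h1 := norm_sq_eq_lor q
  have h2 := one_le_last_of_mem_hyp hpH
  have h3 := one_le_last_of_mem_hyp hqH
  rw [hpH.1, hqH.1] at h
  rw [hqH.1] at h1
  set τ := q (Fin.last n)
  set σ := p (Fin.last n)
  have h4 : τ * τ ≤ 2 * (σ * -lor p q) * τ := by
    linear_combination h + one_le_pow₀ (n := 2) h2 + sq_nonneg (lor p q)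
  have h5 : τ ≤ 2 * (σ * -lor p q) := le_of_mul_le_mul_right h4 (by linarith)
  have h6 : τ ≤ 2 * (σ * Real.cosh R) := h5.trans (by gcongr)
  have h7 : ‖q‖ ≤ 2 * τ := by
    refine abs_le_of_sq_le_sq' ?_ (by positivity) |>.2
    nlinarith
  linarith

/-- A function that is `C¹` up to `K` has a derivative that extends continuously to `K`. -/
lemma ContDiffUpTo.exists_fderiv_ext {k : ℕ} (hk : 1 ≤ k) {f : L n → ℝ} {U K : Set (L n)}
    (h : ContDiffUpTo k f U K) :
    ∃ g : L n → (L n →L[ℝ] ℝ), ContinuousOn g K ∧ Set.EqOn (fderiv ℝ f) g U := by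
  obtain ⟨g, hg, hgU⟩ := h.2.2 1 hk
  refine ⟨fun x => continuousMultilinearCurryFin1 ℝ (L n) ℝ (g x),
    (continuousMultilinearCurryFin1 ℝ (L n) ℝ).continuous.comp_continuousOn hg, fun x hx => ?_⟩
  ext X
  simp only [← hgU hx]
  simp [iteratedFDeriv_one_apply]

/-- `extendFrom` is meaningful only where the limit exists; the continuous extension of the first
derivative supplies that limit at every point of the closure. -/
lemma hgradBar_spec {u : L n → ℝ} {k : ℕ} (hk : 1 ≤ k) (hu : MemCkClosure k u Ω) :
    ContinuousOn (hgradBar u Ω) (closure Ω) ∧ Set.EqOn (hgradBar u Ω) (hgrad u) Ω := by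
  obtain ⟨g, hg, hgU⟩ := ContDiffUpTo.exists_fderiv_ext hk hu
  have h1 : ∀ x ∈ closure Ω, Tendsto (hgrad u) (𝓝[Ω] x) (𝓝 (sharp (g x))) := by
    intro x hx
    have h2 : ContinuousWithinAt (fun y => sharpL (g y)) Ω x :=
      (sharpL (n := n)).continuous.continuousAt.comp_continuousWithinAt
        ((hg x (subset_cone _ hx)).mono (subset_closure.trans (subset_cone _)))
    refine h2.tendsto.congr' ?_
    filter_upwards [self_mem_nhdsWithin] with y hy
    rw [sharpL_apply, ← hgU (subset_cone Ω hy)]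
    rfl
  refine ⟨continuousOn_extendFrom subset_rfl fun x hx => ⟨_, h1 x hx⟩, fun x hx => ?_⟩
  rw [hgradBar, extendFrom_eq (subset_closure hx) (h1 x (subset_closure hx)),
    ← hgU (subset_cone Ω hx)]
  rfl

end Domain

/-! ### The maximum principle on the closure -/

lemma log_nu {q X : L n} (hq : q ∈ hyp n) (hX : lor X q = 0) (hX1 : lor X X < 1) :
    Real.log (nu X) = -(1 / 2) * Real.log (1 - lor X X) := by
  rw [nu_of_tangent hq hX, Real.log_inv, Real.log_sqrt (by linarith)]
  ring

lemma nu_pos {q X : L n} (hq : q ∈ hyp n) (hX : lor X q = 0) (hX1 : lor X X < 1) :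
    0 < nu X := by
  rw [nu_of_tangent hq hX]
  exact inv_pos.2 (Real.sqrt_pos.2 (by linarith))

/-- Reduction of the gradient bound to a bound at interior maxima of the auxiliary function. -/
lemma nu_hgrad_le {Ω : Set (L n)} (hΩ : IsBoundedDomain Ω) {H : L n → ℝ} {t : ℝ} {u : L n → ℝ}
    (hu : MemCkClosure 3 u Ω) (hsol : IsSolution Ω H t u) {M K ν₀ : ℝ} (hM : ∀ q ∈ Ω, |u q| ≤ M)
    (hbd : ∀ q ∈ bdry Ω, lmod (hgradBar u Ω q) < 1 ∧ nu (hgradBar u Ω q) ≤ ν₀)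
    (hint : ∀ q ∈ Ω, IsLocalMax (aux u) q → nu (hgrad u q) ≤ K) {q : L n} (hq : q ∈ Ω) :
    nu (hgrad u q) ≤ max ν₀ (K * Real.exp (n / 2 * M ^ 2)) := by
  have hS := isOpen_cone hΩ.isOpen
  have hcl := hΩ.closure_subset_hyp
  obtain ⟨hPc, hPe⟩ := hgradBar_spec (by norm_num) hu
  set P := hgradBar u Ω
  have hlorc : ∀ {f g : L n → L n}, ContinuousOn f (closure Ω) → ContinuousOn g (closure Ω) →
      ContinuousOn (fun x => lor (f x) (g x)) (closure Ω) := fun hf hg =>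
    (lorL (n := n)).continuous₂.comp_continuousOn (hf.prodMk hg)
  have htan : ∀ x ∈ closure Ω, lor (P x) x = 0 := by
    have h1 : Set.EqOn (fun x => lor (P x) x) (fun _ => 0) Ω := fun x hx => by
      simp only [hPe hx]
      exact lor_hgrad_self hS hu.1 (subset_cone Ω hx)
    exact h1.of_subset_closure (hlorc hPc continuousOn_id) continuousOn_const subset_closure
      subset_rfl
  have hlt : ∀ x ∈ closure Ω, lor (P x) (P x) < 1 := by
    intro x hx
    refine lor_lt_one_of_lmod_lt_one (hcl hx) (htan x hx) ?_
    by_cases hxΩ : x ∈ Ω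
    · rw [hPe hxΩ]; exact hsol.spacelike x hxΩ
    · exact (hbd x ⟨hx, hxΩ⟩).1
  have huc : ContinuousOn u (closure Ω) :=
    (hu.2.1.mono (subset_cone _)).congr fun x hx => (radialExt_of_mem_hyp u (hcl hx)).symm
  set Ψ : L n → ℝ := fun x => Real.log (nu (P x)) + n / 2 * u x ^ 2 with hΨ
  have hΨc : ContinuousOn Ψ (closure Ω) := by
    refine ContinuousOn.add ?_ (continuousOn_const.mul (huc.pow 2))
    have h1 : ContinuousOn (fun x => -(1 / 2) * Real.log (1 - lor (P x) (P x))) (closure Ω) :=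
      continuousOn_const.mul ((continuousOn_const.sub (hlorc hPc hPc)).log fun x hx => by
        
        have := hlt x hx
        simp only [Pi.sub_apply]
        linarith)
    exact h1.congr fun x hx => log_nu (hcl hx) (htan x hx) (hlt x hx)
  have hΨaux : ∀ x ∈ Ω, aux u x = Ψ x := by
    intro x hx
    have hx' := subset_closure hx
    simp only [hΨ]
    rw [log_nu (hcl hx') (htan x hx') (hlt x hx'), hPe hx, aux, (hcl hx').1,
      radialExt_of_mem_hyp u (hcl hx')]
    congr 3
    ring
  obtain ⟨q₀, hq₀, hmax⟩ := hΩ.isCompact_closure.exists_isMaxOn ⟨q, subset_closure hq⟩ hΨc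
  have hq' := subset_closure hq
  have h1 : Real.log (nu (hgrad u q)) ≤ Ψ q₀ := by
    have h2 : Ψ q ≤ Ψ q₀ := hmax hq'
    have h3 : 0 ≤ n / 2 * u q ^ 2 := by positivity
    rw [← hPe hq]
    simp only [hΨ] at h2 ⊢
    linarith
  have hnu : 0 < nu (hgrad u q) := by
    rw [← hPe hq]; exact nu_pos (hcl hq') (htan q hq') (hlt q hq')
  have hnu₀ : 0 < nu (P q₀) := nu_pos (hcl hq₀) (htan q₀ hq₀) (hlt q₀ hq₀)
  by_cases hq₀Ω : q₀ ∈ Ω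
  · refine le_max_of_le_right ?_
    -- Homogeneity of degree 0 turns a maximum over `Ω` into a local maximum on the open cone.
    have hloc : IsLocalMax (aux u) q₀ := by
      filter_upwards [hS.mem_nhds (subset_cone Ω hq₀Ω)] with x hx
      obtain ⟨h4, h5⟩ := lor_neg_of_mem_cone hΩ.subset_hyp hx
      rw [← aux_smul u (inv_pos.2 (lmod_pos h4)) x, hΨaux _ h5, hΨaux _ hq₀Ω]
      exact hmax (subset_closure h5)
    have h6 := hint q₀ hq₀Ω hloc
    -- Passing from `q₀` to `q` costs at most `(n/2) u(q₀)² ≤ (n/2) M²` in `log ν`, hence the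
    -- exponential factor.
    have h7 : u q₀ ^ 2 ≤ M ^ 2 := sq_le_sq.2 ((hM q₀ hq₀Ω).trans (le_abs_self M))
    rw [← hPe hq₀Ω] at h6
    rw [← Real.log_le_log_iff hnu (by have := hnu₀.trans_le h6; positivity),
      Real.log_mul (hnu₀.trans_le h6).ne' (Real.exp_pos _).ne', Real.log_exp]
    refine h1.trans (add_le_add (Real.log_le_log hnu₀ h6) ?_)
    gcongr
  · refine le_max_of_le_left ?_
    have h4 := hbd q₀ ⟨hq₀, hq₀Ω⟩
    have h5 : u q₀ = 0 := hsol.boundary q₀ ⟨hq₀, hq₀Ω⟩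
    rw [← Real.log_le_log_iff hnu (hnu₀.trans_le h4.2)]
    refine h1.trans ?_
    simp only [hΨ, h5]
    simpa using Real.log_le_log hnu₀ h4.2

end

end HBump

/-! ### The uniform constant -/

open HBump in
theorem proposition8p1 (n : ℕ) (hn : 2 ≤ n)
    (Ω : Set (HBump.L n)) (hΩ : HBump.IsBoundedDomain Ω)
    (H : HBump.L n → ℝ)
    (hH : HBump.ContDiffUpTo 1 H (HBump.cone Ω) (HBump.cone (closure Ω)))
    (r₁ r₂ : ℝ) (hr : r₁ ≠ r₂) (hr₁ : 0 < r₁) (hr₁' : r₁ ≤ 1) (hr₂ : 1 ≤ r₂)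
    (ν₀ : ℝ) (hν₀ : 0 < ν₀) :
    ∃ C : ℝ, 0 < C ∧
      ∀ t ∈ Set.Icc (0 : ℝ) 1, ∀ u : HBump.L n → ℝ,
        HBump.MemCkClosure 3 u Ω →
        HBump.IsSolution Ω H t u →
        (∀ q ∈ Ω, Real.log r₁ ≤ u q ∧ u q ≤ Real.log r₂) →
        (∀ q ∈ HBump.bdry Ω, HBump.lmod (HBump.hgradBar u Ω q) < 1 ∧
          HBump.nu (HBump.hgradBar u Ω q) ≤ ν₀) →
        ∀ q ∈ Ω, HBump.nu (HBump.hgrad u q) ≤ C := by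
  obtain ⟨g, hg, hgU⟩ := hH.exists_fderiv_ext le_rfl
  have hcomp := hΩ.isCompact_closure
  obtain ⟨Q, hQ⟩ := hcomp.isBounded.exists_norm_le
  -- A compact set containing every argument `e^u q` of `H`, whatever the solution; it yields bounds
  -- on `H` and its derivative independent of `u` and `t`.
  set Z : Set (L n) := (fun z : ℝ × L n => Real.exp z.1 • z.2) ''
    (Set.Icc (Real.log r₁) (Real.log r₂) ×ˢ closure Ω) with hZ
  have hZc : IsCompact Z := (isCompact_Icc.prod hcomp).image (by fun_prop)
  have hZsub : Z ⊆ cone (closure Ω) := by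
    rintro _ ⟨⟨s, x⟩, ⟨_, hx⟩, rfl⟩
    exact ⟨x, hx, Real.exp s, Real.exp_pos s, rfl⟩
  obtain ⟨B₀, hB₀⟩ := hZc.exists_bound_of_continuousOn (hH.2.1.mono hZsub)
  obtain ⟨B₁, hB₁⟩ := hZc.exists_bound_of_continuousOn (hg.mono hZsub)
  set M := max |Real.log r₁| |Real.log r₂|
  -- `K` is the bound of `nu_le_of_isLocalMax_aux` with `B = r₂ B₀`. In `B'`, the factors `r₂ Q` and
  -- `r₂ (1 + 2Q)` bound the two parts of the velocity of `e^u q`, the latter by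
  -- `norm_le_of_tangent`.
  refine ⟨_, lt_max_of_lt_left (b := ν₀) hν₀, fun t ht u hu hsol hlog hbd q hq =>
    nu_hgrad_le hΩ hu hsol (M := M) (K := 1 + n * ((r₂ * B₀ + r₂ * (B₁ * (r₂ * Q + r₂ * (1 + 2 * Q))))
      + r₂ * B₀ * (n * M)) + n * M * (n * (1 + r₂ * B₀)))
      (fun q hq => abs_le_max_abs_abs (hlog q hq).1 (hlog q hq).2) hbd (fun x hx hloc => ?_) hq⟩
  have hxH := hΩ.subset_hyp hx
  have hS := isOpen_cone hΩ.isOpen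
  have hpx := lor_hgrad_self hS hu.1 (subset_cone Ω hx)
  have hw := lor_lt_one_of_lmod_lt_one hxH hpx (hsol.spacelike x hx)
  have hw0 := lor_self_nonneg_of_tangent x hxH _ hpx
  have hpn := norm_le_of_tangent hxH hpx hw.le
  have hxQ := hQ x (subset_closure hx)
  have hQ0 : 0 ≤ Q := (norm_nonneg _).trans hxQ
  have hux := radialExt_of_mem_hyp u hxH
  have hZx : Real.exp (u x) • x ∈ Z := ⟨(u x, x), ⟨hlog x hx, subset_closure hx⟩, rfl⟩
  have ha : Real.exp (u x) ≤ r₂ := by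
    rw [← Real.exp_log (by linarith : 0 < r₂)]
    exact Real.exp_le_exp.2 (hlog x hx).2
  have ha0 := Real.exp_pos (u x)
  have hb0 := hB₀ _ hZx
  have hb1 := hB₁ _ hZx
  rw [← hgU (smul_mem_cone (subset_cone Ω hx) ha0)] at hb1
  have hr0 : 0 ≤ r₂ := by linarith
  have hB00 : 0 ≤ B₀ := (norm_nonneg _).trans hb0
  have hB10 : 0 ≤ B₁ := (norm_nonneg _).trans hb1
  refine nu_le_of_isLocalMax_aux hΩ.isOpen ht hsol hu.1 (hH.1.differentiableOn (by norm_num)) hx rfl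
    hloc (a := Real.exp (u x)) (by rw [hux]) ?_ ?_ ?_
  · rw [hux]; exact abs_le_max_abs_abs (hlog x hx).1 (hlog x hx).2
  · rw [abs_mul, abs_of_pos ha0]
    exact mul_le_mul ha hb0 (abs_nonneg _) hr0
  · refine (abs_add_le _ _).trans (add_le_add ?_ ?_)
    · rw [abs_mul, abs_mul, abs_of_pos ha0, abs_of_nonneg hw0]
      refine mul_le_mul ?_ hb0 (abs_nonneg _) hr0
      nlinarith
    · rw [abs_mul, abs_of_pos ha0]
      refine mul_le_mul ha ?_ (abs_nonneg _) hr0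
      refine (ContinuousLinearMap.le_opNorm _ _).trans (mul_le_mul hb1 ?_ (norm_nonneg _) hB10)
      refine (norm_add_le _ _).trans (add_le_add ?_ ?_)
      · rw [norm_smul, Real.norm_eq_abs, abs_of_nonneg (mul_nonneg ha0.le hw0)]
        refine mul_le_mul ?_ hxQ (norm_nonneg _) hr0
        nlinarith
      · rw [norm_smul, Real.norm_eq_abs, abs_of_pos ha0]
        refine mul_le_mul ha ?_ (norm_nonneg _) hr0
        linarith
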